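/- Let $\mathbb H^2$ be the hyperbolic plane, $O\in\mathbb H^2$, and $(r,\theta)$ geodesic polar coordinates centred at $O$, so that the metric is $dr^2+\sinh^2 r\,d\theta^2$. Let $\Omega\subset\mathbb H^2$ be a nonempty connected open set invariant under the rotations about $O$. For $\varepsilon\in\{+1,-1\}$ and $q>0$, $q\neq 1$, consider $$\Delta_{\mathbb H^2}u=\varepsilon\,u|u|^{q-1}\qquad(1)$$ in $\Omega$. A solution is a $C^2$ function on $\Omega\setminus\{O\}$ satisfying the equation there (it may be singular at $O$ if $O\in\Omega$). It is pseudo-radial if $u(r,\theta)=h(r)w(\theta)$ on $\Omega\setminus\{O\}$ for some functions $h$ and $w$, with $w$ $2\pi$-periodic, and radial if it depends only on $r$. (i) If $\varepsilon=+1$ or $q\neq 3$, then every pseudo-radial solution of (1) is radial. (ii) The equation $\Delta_{\mathbb H^2}u=-u^3$ has infinitely many non-radial pseudo-radial solutions in $\Omega$. More precisely, for every integer $k\ge 2$ the ordinary differential equation $$w''+w=-w^3\quad\text{on }\mathbb R$$ has a solution $w_k$ with $w_k(0)=0$ and least period $2\pi/k$; it is the unique one up to sign, and every solution with least period $2\pi/k$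 is a translate $w_k(\cdot+\theta_0)$ of it. For every integer $k\ge2$ the function $w_k(\theta)/\sinh r$ is a non-radial pseudo-radial solution, and the non-radial pseudo-radial solutions of $\Delta_{\mathbb H^2}u=-u^3$ in $\Omega$ are exactly the functions $$u(r,\theta)=\frac{w_k(\theta+\theta_0)}{\sinh r},\qquad k\ge 2,\ \theta_0\in\mathbb R .$$ -/

import Mathlib

noncomputable section

namespace HypPlane

/-- The hyperbolic plane is the unit disc of `ℂ` with the metric `λ(z)² |dz|²`, of curvature `-1`,
where `λ(z) = 2 / (1 - |z|²)`. -/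
def conformalFactor (z : ℂ) : ℝ := 2 / (1 - ‖z‖ ^ 2)

/-- The Laplace-Beltrami operator of the conformal metric `λ(z)² |dz|²`: in dimension two it is
`λ⁻²` times the Euclidean Laplacian. -/
def hypLaplacian (u : ℂ → ℝ) (z : ℂ) : ℝ := (conformalFactor z ^ 2)⁻¹ * Laplacian.laplacian u z

/-- Geodesic polar coordinates centred at `0`: the point at hyperbolic distance `r` from `0`
(that is, at Euclidean distance `tanh (r / 2)`) in the direction `θ`. In these coordinates the
metric is `dr² + sinh² r dθ²`. -/
def polar (r θ : ℝ) : ℂ := (Real.tanh (r / 2) : ℂ) * Complex.exp (θ * Complex.I)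

/-- A rotationally symmetric domain of the hyperbolic plane, with centre `0`: a nonempty connected
open subset of the disc that is invariant under all rotations about `0`. -/
structure IsRotSymmDomain (Ω : Set ℂ) : Prop where
  subset_disc : Ω ⊆ Metric.ball 0 1
  isOpen : IsOpen Ω
  isConnected : IsConnected Ω
  rot_mem : ∀ z ∈ Ω, ∀ θ : ℝ, Complex.exp (θ * Complex.I) * z ∈ Ω

/-- `u` is a classical, possibly singular at the centre, solution of `Δ u = F(u)` in `Ω`.
Only the values of `u` in `Ω` outside the centre matter. -/
def IsSolution (Ω : Set ℂ) (F : ℝ → ℝ) (u : ℂ → ℝ) : Prop :=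
  ContDiffOn ℝ 2 u (Ω \ {0}) ∧ ∀ z ∈ Ω \ {0}, hypLaplacian u z = F (u z)

/-- `u = h(r) w(θ)` in `Ω`, with `w` a `2π`-periodic function. -/
def IsPseudoRadial (Ω : Set ℂ) (u : ℂ → ℝ) : Prop :=
  ∃ h w : ℝ → ℝ, Function.Periodic w (2 * Real.pi) ∧
    ∀ r θ : ℝ, 0 < r → polar r θ ∈ Ω → u (polar r θ) = h r * w θ

/-- `u` depends only on `r` in `Ω`. -/
def IsRadial (Ω : Set ℂ) (u : ℂ → ℝ) : Prop :=
  ∃ f : ℝ → ℝ, ∀ r θ : ℝ, 0 < r → polar r θ ∈ Ω → u (polar r θ) = f r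

/-- The non-radial pseudo-radial solutions of `Δ u = F(u)` in `Ω`. -/
def nonRadialPseudoRadialSolutions (Ω : Set ℂ) (F : ℝ → ℝ) : Set (ℂ → ℝ) :=
  {u | IsSolution Ω F u ∧ IsPseudoRadial Ω u ∧ ¬ IsRadial Ω u}

/-- `T` is the least positive period of `w`. -/
def IsLeastPeriod (w : ℝ → ℝ) (T : ℝ) : Prop :=
  IsLeast {S : ℝ | 0 < S ∧ Function.Periodic w S} T

/-- `w` is a solution on the whole line of `w'' + w = -w³` with least period `2π/k`. -/
def IsModeSolution (k : ℕ) (w : ℝ → ℝ) : Prop :=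
  ContDiff ℝ 2 w ∧ (∀ θ : ℝ, deriv (deriv w) θ + w θ = -(w θ) ^ 3) ∧
    IsLeastPeriod w (2 * Real.pi / k)

end HypPlane

end

/-!
In the conformal coordinates `log z = ρ + iθ` the equation for `u = H(ρ) w(θ)` becomes
`H'' w + H w'' = ε (H w) |H w|^(q-1) / sinh² ρ`. If `w` is not constant then `|w|` takes two
different nonzero values, so `H'' / H = A` and `|H|^(q-1) / sinh² ρ` are constant where `H ≠ 0`.
The second relation is `H' / H = m coth ρ` with `m = 2 / (q - 1)`; it is compatible with the first
only if `m = A = 1`. Hence `q = 3` and `H = -C sinh ρ = C / sinh r`, while `v = C w` solves the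
Duffing equation `v'' + v = ε v³`.

A nonconstant periodic solution of the Duffing equation is a translate of `a sin φ(t)`, where the
phase `φ` advances by `π` in a time `T(a)` given by an elliptic integral. If `ε > 0` then
`T(a) > π`, which excludes the period `2π`. If `ε = -1` then `T` decreases from `π` to `0` as `a`
runs over `(0, ∞)`, so the least period `2 T(a) = 2π / k` is attained exactly once for each
`k ≥ 2`, and never for `k = 1`.
-/

namespace HypPlane

open Set Real Filter Topology

/-! ### The Duffing equation -/

theorem eq_of_hasDerivAt_of_hasDerivAt {E : Type*} [NormedAddCommGroup E] [NormedSpace ℝ E]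
    [CompleteSpace E] {f : E → E} (hf : ContDiff ℝ 1 f) {x x' y y' : ℝ → E}
    (hx : ∀ t, HasDerivAt x (x' t) t) (hx' : ∀ t, HasDerivAt x' (f (x t)) t)
    (hy : ∀ t, HasDerivAt y (y' t) t) (hy' : ∀ t, HasDerivAt y' (f (y t)) t)
    {t₀ : ℝ} (h : x t₀ = y t₀) (h' : x' t₀ = y' t₀) : x = y := by
  let V : E × E → E × E := fun p => (p.2, f p.1)
  have hV : ContDiff ℝ 1 V := contDiff_snd.prodMk (hf.comp contDiff_fst)
  have key : (fun t => (x t, x' t)) = fun t => (y t, y' t) :=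
    isMIntegralCurve_Ioo_eq_of_contMDiff_boundaryless (v := V) (t₀ := t₀)
      (contMDiff_vectorSpace_iff_contDiff.2 hV)
      (fun t => ((hx t).prodMk (hx' t)).hasFDerivAt.hasMFDerivAt)
      (fun t => ((hy t).prodMk (hy' t)).hasFDerivAt.hasMFDerivAt)
      (Prod.ext h h')
  exact funext fun t => congrArg Prod.fst (congrFun key t)

theorem deriv_deriv_nonpos_of_isLocalMax {f : ℝ → ℝ} {x : ℝ} (h : IsLocalMax f x)
    (hf : ContinuousAt f x) : deriv (deriv f) x ≤ 0 := by
  by_contra! hpos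
  have hmin : IsLocalMin f x := isLocalMin_of_deriv_deriv_pos hpos h.deriv_eq_zero hf
  have hconst : f =ᶠ[𝓝 x] fun _ => f x :=
    h.and hmin |>.mono fun t ht => le_antisymm ht.1 ht.2
  have : deriv (deriv f) x = 0 := by simpa using hconst.deriv.deriv.eq_of_nhds
  exact hpos.ne' this

/-- The Duffing equation `v'' + v = c v³` on the whole line, for `C²` functions. It is the equation
of the angular factor of a separated solution of `Δ u = c u³`. -/
def IsDuffing (c : ℝ) (v : ℝ → ℝ) : Prop :=
  ContDiff ℝ 2 v ∧ ∀ t, deriv (deriv v) t + v t = c * v t ^ 3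

namespace IsDuffing

variable {c : ℝ} {v w : ℝ → ℝ}

theorem hasDerivAt (hv : IsDuffing c v) (t : ℝ) : HasDerivAt v (deriv v t) t :=
  (hv.1.differentiable two_ne_zero t).hasDerivAt

theorem deriv_deriv (hv : IsDuffing c v) (t : ℝ) :
    deriv (deriv v) t = c * v t ^ 3 - v t :=
  eq_sub_of_add_eq (hv.2 t)

theorem hasDerivAt_deriv (hv : IsDuffing c v) (t : ℝ) :
    HasDerivAt (deriv v) (c * v t ^ 3 - v t) t :=
  hv.deriv_deriv t ▸ ((hv.1.deriv' (n := 1)).differentiable one_ne_zero t).hasDerivAt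

theorem of_hasDerivAt {v' : ℝ → ℝ} (h : ∀ t, HasDerivAt v (v' t) t)
    (h' : ∀ t, HasDerivAt v' (c * v t ^ 3 - v t) t) : IsDuffing c v := by
  have hv' : deriv v = v' := deriv_eq h
  have hv'' : deriv v' = fun t => c * v t ^ 3 - v t := deriv_eq h'
  have hv : Continuous v := continuous_iff_continuousAt.2 fun t => (h t).continuousAt
  refine ⟨(contDiff_succ_iff_deriv (n := 1)).2
    ⟨fun t => (h t).differentiableAt, by simp, hv'.symm ▸ contDiff_one_iff_deriv.2
      ⟨fun t => (h' t).differentiableAt, hv''.symm ▸ by fun_prop⟩⟩, fun t => ?_⟩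
  rw [hv', hv'', sub_add_cancel]

theorem unique (hv : IsDuffing c v) (hw : IsDuffing c w) {t₀ : ℝ} (h : v t₀ = w t₀)
    (h' : deriv v t₀ = deriv w t₀) : v = w :=
  eq_of_hasDerivAt_of_hasDerivAt (f := fun s => c * s ^ 3 - s) (by fun_prop) hv.hasDerivAt
    hv.hasDerivAt_deriv hw.hasDerivAt hw.hasDerivAt_deriv h h'

theorem comp_add_const (hv : IsDuffing c v) (s : ℝ) : IsDuffing c fun t => v (t + s) :=
  of_hasDerivAt (fun t => (hv.hasDerivAt (t + s)).comp_add_const t s)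
    (fun t => (hv.hasDerivAt_deriv (t + s)).comp_add_const t s)

theorem neg (hv : IsDuffing c v) : IsDuffing c (-v) :=
  of_hasDerivAt (fun t => (hv.hasDerivAt t).neg)
    (fun t => (hv.hasDerivAt_deriv t).neg.congr_deriv (by simp only [Pi.neg_apply]; ring))

theorem eq_const_of_equilibrium (hv : IsDuffing c v) {t₀ : ℝ} (h : c * v t₀ ^ 3 = v t₀)
    (h' : deriv v t₀ = 0) : v = fun _ => v t₀ :=
  hv.unique (of_hasDerivAt (v' := fun _ => 0) (fun t => hasDerivAt_const t _)
    fun t => by simpa only [h, sub_self] using hasDerivAt_const t (0 : ℝ)) rfl (by simp [h'])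

theorem mul_one_sub_nonneg_of_isLocalMax (hv : IsDuffing c v) {t : ℝ} (h : IsLocalMax v t) :
    0 ≤ v t * (1 - c * v t ^ 2) := by
  have := deriv_deriv_nonpos_of_isLocalMax h (hv.hasDerivAt t).continuousAt
  rw [hv.deriv_deriv] at this
  linear_combination this

end IsDuffing

/-- The angular speed `dφ/dt` in the phase `φ` of the solution `v = a sin φ` of `v'' + v = c v³`,
where `μ = c a²`. It comes from the energy identity
`v'² + v² - c v⁴ / 2 = a² - c a⁴ / 2` together with `v' = a cos φ · dφ/dt`. -/
noncomputable def speed (μ φ : ℝ) : ℝ := √(1 - μ * (1 + sin φ ^ 2) / 2)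

/-- The time at which the solution with parameter `μ` and phase `0` at time `0` reaches the
phase `φ`. -/
noncomputable def phaseTime (μ φ : ℝ) : ℝ := ∫ s in (0 : ℝ)..φ, (speed μ s)⁻¹

/-- The time during which the phase advances by `π`. -/
noncomputable def halfPeriod (μ : ℝ) : ℝ := phaseTime μ π

/-- The phase as a function of time. It is meaningful for `μ < 1`, where `phaseTime μ` is
bijective. -/
noncomputable def phase (μ : ℝ) : ℝ → ℝ := Function.invFun (phaseTime μ)

/-- The solution of `v'' + v = c v³` of amplitude `a` that vanishes at `0`. It is meaningful for
`c a² < 1`. -/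
noncomputable def wave (c a t : ℝ) : ℝ := a * sin (phase (c * a ^ 2) t)

section Phase

variable {μ : ℝ}

theorem speed_radicand_pos (hμ : μ < 1) (φ : ℝ) : 0 < 1 - μ * (1 + sin φ ^ 2) / 2 := by
  nlinarith [sin_sq_le_one φ, sq_nonneg (sin φ)]

theorem speed_pos (hμ : μ < 1) (φ : ℝ) : 0 < speed μ φ := sqrt_pos.2 (speed_radicand_pos hμ φ)

theorem speed_sq (hμ : μ < 1) (φ : ℝ) : speed μ φ ^ 2 = 1 - μ * (1 + sin φ ^ 2) / 2 :=
  sq_sqrt (speed_radicand_pos hμ φ).le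

theorem speed_lt_speed {ν : ℝ} (h : μ < ν) (hμ : μ < 1) (φ : ℝ) : speed ν φ < speed μ φ :=
  (sqrt_lt_sqrt_iff_of_pos (speed_radicand_pos hμ φ)).2 (by nlinarith [sq_nonneg (sin φ)])

theorem continuous_inv_speed (hμ : μ < 1) : Continuous fun φ => (speed μ φ)⁻¹ :=
  Continuous.inv₀ (by unfold speed; fun_prop) fun φ => (speed_pos hμ φ).ne'

theorem periodic_inv_speed (μ : ℝ) : Function.Periodic (fun φ => (speed μ φ)⁻¹) π := fun φ => by
  simp only [speed, sin_add_pi, neg_sq]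

theorem hasDerivAt_speed (hμ : μ < 1) (φ : ℝ) :
    HasDerivAt (speed μ) (-(μ * (sin φ * cos φ)) / (2 * speed μ φ)) φ := by
  have h : HasDerivAt (fun φ => 1 - μ * (1 + sin φ ^ 2) / 2) (-(μ * (sin φ * cos φ))) φ :=
    ((((((hasDerivAt_sin φ).fun_pow 2).const_add 1).const_mul μ).div_const 2).const_sub 1)
      |>.congr_deriv (by push_cast; ring)
  exact h.sqrt (speed_radicand_pos hμ φ).ne'

theorem hasDerivAt_phaseTime (hμ : μ < 1) (φ : ℝ) :
    HasDerivAt (phaseTime μ) (speed μ φ)⁻¹ φ :=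
  ((continuous_inv_speed hμ).integral_hasStrictDerivAt 0 φ).hasDerivAt

theorem phaseTime_zero (μ : ℝ) : phaseTime μ 0 = 0 := intervalIntegral.integral_same

theorem phaseTime_int_mul_pi (hμ : μ < 1) (n : ℤ) : phaseTime μ (n * π) = n * halfPeriod μ := by
  simpa [phaseTime, halfPeriod] using (periodic_inv_speed μ).intervalIntegral_add_zsmul_eq n 0
    fun _ _ => (continuous_inv_speed hμ).intervalIntegrable _ _

theorem phaseTime_add_pi (hμ : μ < 1) (φ : ℝ) :
    phaseTime μ (φ + π) = phaseTime μ φ + halfPeriod μ := by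
  have hint := (continuous_inv_speed hμ).intervalIntegrable (μ := MeasureTheory.volume)
  rw [phaseTime, ← intervalIntegral.integral_add_adjacent_intervals (hint 0 φ) (hint φ _),
    (periodic_inv_speed μ).intervalIntegral_add_eq φ 0, zero_add]
  rfl

theorem strictMono_phaseTime (hμ : μ < 1) : StrictMono (phaseTime μ) :=
  strictMono_of_hasDerivAt_pos (hasDerivAt_phaseTime hμ) fun φ => inv_pos.2 (speed_pos hμ φ)

theorem halfPeriod_pos (hμ : μ < 1) : 0 < halfPeriod μ :=
  phaseTime_zero μ ▸ strictMono_phaseTime hμ pi_pos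

theorem surjective_phaseTime (hμ : μ < 1) : Function.Surjective (phaseTime μ) :=
  (continuous_iff_continuousAt.2 fun φ => (hasDerivAt_phaseTime hμ φ).continuousAt).surjective
    ((periodic_inv_speed μ).tendsto_atTop_intervalIntegral_of_pos (halfPeriod_pos hμ) pi_pos)
    ((periodic_inv_speed μ).tendsto_atBot_intervalIntegral_of_pos (halfPeriod_pos hμ) pi_pos)

theorem phaseTime_phase (hμ : μ < 1) (t : ℝ) : phaseTime μ (phase μ t) = t :=
  Function.rightInverse_invFun (surjective_phaseTime hμ) t

theorem phase_phaseTime (hμ : μ < 1) (φ : ℝ) : phase μ (phaseTime μ φ) = φ :=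
  Function.leftInverse_invFun (strictMono_phaseTime hμ).injective φ

theorem phase_add_halfPeriod (hμ : μ < 1) (t : ℝ) :
    phase μ (t + halfPeriod μ) = phase μ t + π := by
  rw [← phase_phaseTime hμ (phase μ t + π), phaseTime_add_pi hμ, phaseTime_phase hμ]

theorem continuous_phase (hμ : μ < 1) : Continuous (phase μ) :=
  Monotone.continuous_of_surjective
    (fun s t hst => (strictMono_phaseTime hμ).le_iff_le.1 <| by
      rwa [phaseTime_phase hμ, phaseTime_phase hμ])
    (Function.LeftInverse.surjective (phase_phaseTime hμ))

theorem hasDerivAt_phase (hμ : μ < 1) (t : ℝ) : HasDerivAt (phase μ) (speed μ (phase μ t)) t :=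
  inv_inv (speed μ (phase μ t)) ▸
    (hasDerivAt_phaseTime hμ (phase μ t)).of_local_left_inverse (continuous_phase hμ).continuousAt
      (inv_ne_zero (speed_pos hμ _).ne') (Eventually.of_forall (phaseTime_phase hμ))

end Phase

section Wave

variable {c a : ℝ}

theorem hasDerivAt_wave (h : c * a ^ 2 < 1) (t : ℝ) :
    HasDerivAt (wave c a)
      (a * cos (phase (c * a ^ 2) t) * speed (c * a ^ 2) (phase (c * a ^ 2) t)) t :=
  ((hasDerivAt_phase h t).sin.const_mul a).congr_deriv (by ring)

theorem isDuffing_wave (h : c * a ^ 2 < 1) : IsDuffing c (wave c a) := by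
  refine .of_hasDerivAt (hasDerivAt_wave h) fun t => ?_
  have hφ := hasDerivAt_phase h t
  refine ((hφ.cos.const_mul a).mul ((hasDerivAt_speed h _).comp t hφ)).congr_deriv ?_
  have hσ := (speed_pos h (phase (c * a ^ 2) t)).ne'
  have hσ2 := speed_sq h (phase (c * a ^ 2) t)
  have hcos := cos_sq' (phase (c * a ^ 2) t)
  simp only [Function.comp_apply, wave]
  generalize phase (c * a ^ 2) t = φ at *
  generalize speed (c * a ^ 2) φ = σ at *
  field_simp
  linear_combination (-2 * a * sin φ) * hσ2 - c * a ^ 3 * sin φ * hcos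

theorem wave_phaseTime (h : c * a ^ 2 < 1) (φ : ℝ) :
    wave c a (phaseTime (c * a ^ 2) φ) = a * sin φ := by
  rw [wave, phase_phaseTime h]

theorem wave_zero (h : c * a ^ 2 < 1) : wave c a 0 = 0 := by
  simpa [phaseTime_zero] using wave_phaseTime h 0

theorem wave_add_int_mul_halfPeriod (h : c * a ^ 2 < 1) (t : ℝ) (n : ℤ) :
    wave c a (t + n * halfPeriod (c * a ^ 2)) = (-1) ^ n * wave c a t := by
  have hanti : Function.Antiperiodic (wave c a) (halfPeriod (c * a ^ 2)) := fun t => by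
    rw [wave, phase_add_halfPeriod h, sin_add_pi, mul_neg, wave]
  rw [hanti.add_int_mul_eq n, Int.cast_negOnePow]

theorem wave_eq_zero_iff (ha : a ≠ 0) (h : c * a ^ 2 < 1) {t : ℝ} :
    wave c a t = 0 ↔ ∃ n : ℤ, t = n * halfPeriod (c * a ^ 2) := by
  constructor
  · intro ht
    obtain ⟨n, hn⟩ := sin_eq_zero_iff.1 ((mul_eq_zero.1 ht).resolve_left ha)
    exact ⟨n, by rw [← phaseTime_int_mul_pi h, hn, phaseTime_phase h]⟩
  · rintro ⟨n, rfl⟩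
    rw [← zero_add (_ * _), wave_add_int_mul_halfPeriod h, wave_zero h, mul_zero]

theorem periodic_wave_iff (ha : a ≠ 0) (h : c * a ^ 2 < 1) {T : ℝ} :
    Function.Periodic (wave c a) T ↔ ∃ m : ℤ, T = m * (2 * halfPeriod (c * a ^ 2)) := by
  constructor
  · intro hT
    obtain ⟨n, rfl⟩ := (wave_eq_zero_iff ha h).1 (hT.eq.trans (wave_zero h))
    rcases Int.even_or_odd n with ⟨m, rfl⟩ | hn
    · exact ⟨m, by push_cast; ring⟩
    · have hmax := hT (phaseTime (c * a ^ 2) (π / 2))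
      rw [wave_add_int_mul_halfPeriod h, hn.neg_one_zpow, neg_one_mul, wave_phaseTime h,
        sin_pi_div_two, mul_one] at hmax
      exact absurd (neg_eq_self.1 hmax) ha
  · rintro ⟨m, rfl⟩ t
    rw [mul_left_comm, ← mul_assoc, ← Int.cast_ofNat, ← Int.cast_mul,
      wave_add_int_mul_halfPeriod h, (even_two_mul m).neg_one_zpow, one_mul]

theorem isLeastPeriod_wave (ha : a ≠ 0) (h : c * a ^ 2 < 1) :
    IsLeastPeriod (wave c a) (2 * halfPeriod (c * a ^ 2)) := by
  have hP := halfPeriod_pos h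
  refine ⟨⟨by positivity, (periodic_wave_iff ha h).2 ⟨1, by simp⟩⟩, ?_⟩
  rintro T ⟨hT, hper⟩
  obtain ⟨m, rfl⟩ := (periodic_wave_iff ha h).1 hper
  have hm : 0 < (m : ℝ) := pos_of_mul_pos_left hT (by positivity)
  have : (1 : ℝ) ≤ m := by exact_mod_cast hm
  exact le_mul_of_one_le_left (by positivity) this

end Wave

theorem halfPeriod_zero : halfPeriod 0 = π := by simp [halfPeriod, phaseTime, speed]

theorem strictMonoOn_halfPeriod : StrictMonoOn halfPeriod (Iio 1) := fun _ hμ _ hν h =>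
  intervalIntegral.integral_lt_integral_of_continuousOn_of_le_of_exists_lt pi_pos
    (continuous_inv_speed hμ).continuousOn (continuous_inv_speed hν).continuousOn
    (fun φ _ => (inv_strictAnti₀ (speed_pos hν φ) (speed_lt_speed h hμ φ)).le)
    ⟨0, left_mem_Icc.2 pi_pos.le, inv_strictAnti₀ (speed_pos hν 0) (speed_lt_speed h hμ 0)⟩

theorem pi_lt_halfPeriod {μ : ℝ} (h0 : 0 < μ) (h1 : μ < 1) : π < halfPeriod μ :=
  halfPeriod_zero ▸ strictMonoOn_halfPeriod (mem_Iio.2 one_pos) h1 h0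

theorem halfPeriod_lt_pi {μ : ℝ} (h : μ < 0) : halfPeriod μ < π :=
  halfPeriod_zero ▸ strictMonoOn_halfPeriod (h.trans one_pos) (mem_Iio.2 one_pos) h

theorem halfPeriod_le_pi_div {μ m : ℝ} (hμ : μ ≤ 0) (hm : 0 < m) (h : m ^ 2 ≤ 1 - μ / 2) :
    halfPeriod μ ≤ π / m := by
  have hspeed : ∀ φ, m ≤ speed μ φ := fun φ =>
    le_sqrt_of_sq_le (by nlinarith [mul_nonneg (neg_nonneg.2 hμ) (sq_nonneg (sin φ))])
  calc halfPeriod μ ≤ ∫ _ in (0 : ℝ)..π, m⁻¹ :=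
        intervalIntegral.integral_mono_on pi_pos.le
          ((continuous_inv_speed (hμ.trans_lt one_pos)).intervalIntegrable _ _)
          intervalIntegrable_const fun φ _ => inv_anti₀ hm (hspeed φ)
    _ = π / m := by simp [div_eq_mul_inv]

theorem neg_one_mul_sq_neg {a : ℝ} (ha : 0 < a) : -1 * a ^ 2 < 0 := by nlinarith

theorem neg_one_mul_sq_lt_one (a : ℝ) : -1 * a ^ 2 < 1 := by nlinarith [sq_nonneg a]

theorem continuous_halfPeriod_neg_one_mul_sq : Continuous fun a : ℝ => halfPeriod (-1 * a ^ 2) :=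
  intervalIntegral.continuous_parametric_intervalIntegral_of_continuous'
    (f := fun a φ => (speed (-1 * a ^ 2) φ)⁻¹)
    (Continuous.inv₀ (by unfold speed; fun_prop)
      fun p => (speed_pos (neg_one_mul_sq_lt_one p.1) p.2).ne') 0 π

theorem bijOn_halfPeriod_neg_one_mul_sq :
    BijOn (fun a : ℝ => halfPeriod (-1 * a ^ 2)) (Ioi 0) (Ioo 0 π) := by
  refine ⟨fun a ha => ⟨halfPeriod_pos (neg_one_mul_sq_lt_one a),
    halfPeriod_lt_pi (neg_one_mul_sq_neg ha)⟩, fun a ha b hb hab => ?_, fun T hT => ?_⟩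
  · have hsq := strictMonoOn_halfPeriod.injOn (neg_one_mul_sq_lt_one a)
      (neg_one_mul_sq_lt_one b) hab
    exact (pow_left_inj₀ (le_of_lt ha) (le_of_lt hb) two_ne_zero).1 (by linarith)
  · have hb : 0 ≤ 2 * π / T := (div_pos two_pi_pos hT.1).le
    have hlow : halfPeriod (-1 * (2 * π / T) ^ 2) ≤ T := by
      refine (halfPeriod_le_pi_div (m := π / T) (by nlinarith) (div_pos pi_pos hT.1) ?_).trans_eq
        (div_div_cancel₀ pi_ne_zero)
      linarith [sq_nonneg (π / T), show (2 * π / T) ^ 2 = 4 * (π / T) ^ 2 by ring]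
    have hhigh : T ≤ halfPeriod (-1 * 0 ^ 2) := by simpa [halfPeriod_zero] using hT.2.le
    obtain ⟨a, ha, rfl⟩ := intermediate_value_Icc' hb
      continuous_halfPeriod_neg_one_mul_sq.continuousOn ⟨hlow, hhigh⟩
    refine ⟨a, ha.1.lt_of_ne ?_, rfl⟩
    rintro rfl
    simp [halfPeriod_zero] at hT

/-- The amplitude of the solutions of `v'' + v = -v³` whose half-period is `T`. It is meaningful
for `0 < T < π`. -/
noncomputable def amplitude (T : ℝ) : ℝ :=
  Function.invFunOn (fun a : ℝ => halfPeriod (-1 * a ^ 2)) (Ioi 0) T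

theorem amplitude_pos {T : ℝ} (hT : T ∈ Ioo 0 π) : 0 < amplitude T :=
  Function.invFunOn_mem (bijOn_halfPeriod_neg_one_mul_sq.surjOn hT)

theorem halfPeriod_amplitude {T : ℝ} (hT : T ∈ Ioo 0 π) :
    halfPeriod (-1 * amplitude T ^ 2) = T :=
  Function.invFunOn_eq (bijOn_halfPeriod_neg_one_mul_sq.surjOn hT)

theorem amplitude_halfPeriod {a : ℝ} (ha : 0 < a) : amplitude (halfPeriod (-1 * a ^ 2)) = a :=
  bijOn_halfPeriod_neg_one_mul_sq.injOn.leftInvOn_invFunOn ha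

namespace IsDuffing

variable {c : ℝ} {v : ℝ → ℝ}

-- Both `v` and the wave of amplitude `max v`, shifted so that the maxima occur at the same time,
-- have the same initial data there.
theorem exists_eq_wave_of_periodic (hv : IsDuffing c v) {T : ℝ} (hT : T ≠ 0)
    (hper : Function.Periodic v T) (hne : ∃ s t, v s ≠ v t) :
    ∃ a, 0 < a ∧ c * a ^ 2 < 1 ∧ ∃ s, v = fun t => wave c a (t + s) := by
  have hrange : IsCompact (range v) := hper.compact_of_continuous hT hv.1.continuous
  obtain ⟨_, ⟨M, rfl⟩, hM⟩ := hrange.exists_isGreatest (range_nonempty v)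
  obtain ⟨_, ⟨m, rfl⟩, hm⟩ := hrange.exists_isLeast (range_nonempty v)
  have hlt : v m < v M := by
    obtain ⟨s, t, hst⟩ := hne
    by_contra! hle
    have hconst : ∀ t, v t = v M := fun t =>
      le_antisymm (hM (mem_range_self t)) (hle.trans (hm (mem_range_self t)))
    exact hst ((hconst s).trans (hconst t).symm)
  have hMmax : IsLocalMax v M := Eventually.of_forall fun t => hM (mem_range_self t)
  have hmmax : IsLocalMax (-v) m := Eventually.of_forall fun t => neg_le_neg (hm (mem_range_self t))
  have hmM := hv.neg.mul_one_sub_nonneg_of_isLocalMax hmmax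
  have hMM : 0 < v M * (1 - c * v M ^ 2) := by
    refine (hv.mul_one_sub_nonneg_of_isLocalMax hMmax).lt_of_ne fun h => hlt.ne ?_
    exact congrFun (hv.eq_const_of_equilibrium (by linear_combination h) hMmax.deriv_eq_zero) m
  have ha : 0 < v M := by
    by_contra! hle
    have hcM : 1 < c * v M ^ 2 := by nlinarith
    have hc : 0 < c := pos_of_mul_pos_left (one_pos.trans hcM) (sq_nonneg _)
    have hcm : 1 < c * v m ^ 2 := hcM.trans (mul_lt_mul_of_pos_left (by nlinarith) hc)
    simp only [Pi.neg_apply, neg_sq] at hmM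
    nlinarith
  have hμ : c * v M ^ 2 < 1 := sub_pos.1 (pos_of_mul_pos_right hMM ha.le)
  refine ⟨v M, ha, hμ, phaseTime (c * v M ^ 2) (π / 2) - M,
    hv.unique ((isDuffing_wave hμ).comp_add_const _) (t₀ := M) ?_ ?_⟩
  · rw [add_sub_cancel, wave_phaseTime hμ, sin_pi_div_two, mul_one]
  · rw [((hasDerivAt_wave hμ _).comp_add_const M _).deriv, add_sub_cancel, phase_phaseTime hμ,
      cos_pi_div_two, mul_zero, zero_mul, hMmax.deriv_eq_zero]

end IsDuffing

theorem periodic_comp_add_const_iff {v : ℝ → ℝ} {s T : ℝ} :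
    Function.Periodic (fun t => v (t + s)) T ↔ Function.Periodic v T :=
  ⟨fun h => by simpa using h.add_const (-s), fun h => h.add_const s⟩

theorem isLeastPeriod_comp_add_const_iff {v : ℝ → ℝ} {s T : ℝ} :
    IsLeastPeriod (fun t => v (t + s)) T ↔ IsLeastPeriod v T := by
  simp only [IsLeastPeriod, periodic_comp_add_const_iff]

theorem IsLeastPeriod.exists_ne {v : ℝ → ℝ} {T : ℝ} (h : IsLeastPeriod v T) :
    ∃ s t, v s ≠ v t := by
  by_contra! hconst
  have := h.2 ⟨half_pos h.1.1, fun t => hconst _ _⟩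
  linarith [h.1.1]

theorem IsDuffing.exists_two_pi_eq_of_periodic {c : ℝ} {v : ℝ → ℝ} (hv : IsDuffing c v)
    (hper : Function.Periodic v (2 * π)) (hne : ∃ s t, v s ≠ v t) :
    ∃ a, 0 < a ∧ c * a ^ 2 < 1 ∧ (∃ k : ℕ, 0 < k ∧ π = k * halfPeriod (c * a ^ 2)) ∧
      ∃ s, v = fun t => wave c a (t + s) := by
  obtain ⟨a, ha, hμ, s, rfl⟩ := hv.exists_eq_wave_of_periodic two_pi_pos.ne' hper hne
  obtain ⟨m, hm⟩ := (periodic_wave_iff ha.ne' hμ).1 (periodic_comp_add_const_iff.1 hper)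
  have hP := halfPeriod_pos hμ
  have hm0 : 0 < m := by
    have : (0 : ℝ) < m := pos_of_mul_pos_left (hm ▸ two_pi_pos) (by positivity)
    exact_mod_cast this
  lift m to ℕ using hm0.le
  exact ⟨a, ha, hμ, ⟨m, by exact_mod_cast hm0, by push_cast at hm; linarith⟩, s, rfl⟩

theorem IsDuffing.eq_of_periodic_of_pos {c : ℝ} (hc : 0 < c) {v : ℝ → ℝ} (hv : IsDuffing c v)
    (hper : Function.Periodic v (2 * π)) (s t : ℝ) : v s = v t := by
  by_contra hne
  obtain ⟨a, ha, hμ, ⟨k, hk, hkπ⟩, -⟩ := hv.exists_two_pi_eq_of_periodic hper ⟨s, t, hne⟩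
  have hP : π < halfPeriod (c * a ^ 2) := pi_lt_halfPeriod (by positivity) hμ
  have hk1 : (1 : ℝ) ≤ k := by exact_mod_cast hk
  nlinarith [pi_pos]

/-- The solution of `w'' + w = -w³` of least period `2π / k` and positive amplitude that vanishes
at `0`. It is meaningful for `2 ≤ k`. -/
noncomputable def modeWave (k : ℕ) : ℝ → ℝ := wave (-1) (amplitude (π / k))

theorem modeWave_zero (k : ℕ) : modeWave k 0 = 0 := wave_zero (neg_one_mul_sq_lt_one _)

theorem isDuffing_modeWave (k : ℕ) : IsDuffing (-1) (modeWave k) :=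
  isDuffing_wave (neg_one_mul_sq_lt_one _)

theorem isModeSolution_iff {k : ℕ} {v : ℝ → ℝ} :
    IsModeSolution k v ↔ IsDuffing (-1) v ∧ IsLeastPeriod v (2 * π / k) := by
  simp only [IsModeSolution, IsDuffing, and_assoc, neg_one_mul]

theorem IsDuffing.exists_eq_modeWave {v : ℝ → ℝ} (hv : IsDuffing (-1) v)
    (hper : Function.Periodic v (2 * π)) (hne : ∃ s t, v s ≠ v t) :
    ∃ k, 2 ≤ k ∧ ∃ s, v = fun t => modeWave k (t + s) := by
  obtain ⟨a, ha, -, ⟨k, hk, hkπ⟩, s, rfl⟩ := hv.exists_two_pi_eq_of_periodic hper hne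
  have hP : halfPeriod (-1 * a ^ 2) < π := halfPeriod_lt_pi (neg_one_mul_sq_neg ha)
  have hk1 : k ≠ 1 := by rintro rfl; simp only [Nat.cast_one, one_mul] at hkπ; exact hP.ne' hkπ
  have hk0 : (k : ℝ) ≠ 0 := by positivity
  refine ⟨k, by omega, s, ?_⟩
  rw [modeWave, (div_eq_iff hk0).2 (hkπ.trans (mul_comm _ _)), amplitude_halfPeriod ha]

section Mode

variable {k : ℕ} (hk : 2 ≤ k)

include hk

theorem pi_div_mem_Ioo : π / k ∈ Ioo 0 π := by
  have hk' : (1 : ℝ) < k := by exact_mod_cast hk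
  exact ⟨by positivity, div_lt_self pi_pos hk'⟩

theorem isLeastPeriod_modeWave : IsLeastPeriod (modeWave k) (2 * π / k) := by
  have hT := pi_div_mem_Ioo hk
  rw [mul_div_assoc, ← halfPeriod_amplitude hT]
  exact isLeastPeriod_wave (amplitude_pos hT).ne' (neg_one_mul_sq_lt_one _)

theorem isModeSolution_modeWave : IsModeSolution k (modeWave k) :=
  isModeSolution_iff.2 ⟨isDuffing_modeWave k, isLeastPeriod_modeWave hk⟩

theorem periodic_two_pi_of_isLeastPeriod {v : ℝ → ℝ} (hv : IsLeastPeriod v (2 * π / k)) :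
    Function.Periodic v (2 * π) := by
  have := hv.1.2.nat_mul k
  rwa [mul_div_cancel₀ _ (by positivity)] at this

end Mode

theorem natCast_eq_of_isLeastPeriod {v : ℝ → ℝ} {j k : ℕ} (hj : IsLeastPeriod v (2 * π / j))
    (hk : IsLeastPeriod v (2 * π / k)) : j = k := by
  have := inv_injective (mul_left_cancel₀ two_pi_pos.ne' (hj.unique hk))
  exact_mod_cast this

theorem injOn_modeWave : InjOn modeWave {k | 2 ≤ k} := fun _ hj _ hk h =>
  natCast_eq_of_isLeastPeriod (isLeastPeriod_modeWave hj) (h ▸ isLeastPeriod_modeWave hk)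

theorem IsModeSolution.exists_eq_modeWave {k : ℕ} (hk : 2 ≤ k) {v : ℝ → ℝ}
    (hv : IsModeSolution k v) : ∃ s, v = fun t => modeWave k (t + s) := by
  obtain ⟨hd, hp⟩ := isModeSolution_iff.1 hv
  obtain ⟨j, hj, s, rfl⟩ :=
    hd.exists_eq_modeWave (periodic_two_pi_of_isLeastPeriod hk hp) hp.exists_ne
  rw [natCast_eq_of_isLeastPeriod (isLeastPeriod_comp_add_const_iff.1 hp)
    (isLeastPeriod_modeWave hj)]
  exact ⟨s, rfl⟩

theorem IsModeSolution.eq_or_eq_neg {k : ℕ} (hk : 2 ≤ k) {v : ℝ → ℝ}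
    (hv : IsModeSolution k v) (h0 : v 0 = 0) : v = modeWave k ∨ v = -modeWave k := by
  obtain ⟨s, rfl⟩ := hv.exists_eq_modeWave hk
  have hμ := neg_one_mul_sq_lt_one (amplitude (π / k))
  obtain ⟨n, rfl⟩ := (wave_eq_zero_iff (amplitude_pos (pi_div_mem_Ioo hk)).ne' hμ).1
    ((congrArg (modeWave k) (zero_add s)).symm.trans h0)
  rcases Int.even_or_odd n with hn | hn
  · exact Or.inl (funext fun t => by
      rw [modeWave, wave_add_int_mul_halfPeriod hμ, hn.neg_one_zpow, one_mul])
  · exact Or.inr (funext fun t => by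
      rw [modeWave, wave_add_int_mul_halfPeriod hμ, hn.neg_one_zpow, neg_one_mul, Pi.neg_apply])

/-! ### Logarithmic polar coordinates -/

theorem hasDerivAt_deriv_comp {E F : Type*} [NormedAddCommGroup E] [NormedSpace ℝ E]
    [NormedAddCommGroup F] [NormedSpace ℝ F] {u : E → F} {γ γ' : ℝ → E} {γ'' : E} {s : ℝ}
    (hu : ContDiffAt ℝ 2 u (γ s)) (hγ : ∀ t, HasDerivAt γ (γ' t) t) (hγ' : HasDerivAt γ' γ'' s) :
    HasDerivAt (deriv fun t => u (γ t))
      (fderiv ℝ (fderiv ℝ u) (γ s) (γ' s) (γ' s) + fderiv ℝ u (γ s) γ'') s := by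
  have hdiff : ∀ᶠ z in 𝓝 (γ s), DifferentiableAt ℝ u z :=
    (hu.eventually (by simp)).mono fun z hz => hz.differentiableAt two_ne_zero
  have hderiv : (deriv fun t => u (γ t)) =ᶠ[𝓝 s] fun t => fderiv ℝ u (γ t) (γ' t) :=
    ((hγ s).continuousAt.eventually hdiff).mono fun t ht =>
      (ht.hasFDerivAt.comp_hasDerivAt t (hγ t)).deriv
  have hfderiv : HasFDerivAt (fderiv ℝ u) (fderiv ℝ (fderiv ℝ u) (γ s)) (γ s) :=
    ((hu.fderiv_right (m := 1) le_rfl).differentiableAt one_ne_zero).hasFDerivAt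
  exact ((hfderiv.comp_hasDerivAt s (hγ s)).clm_apply hγ').congr_of_eventuallyEq hderiv

theorem apply_self_add_apply_mul_I (B : ℂ →L[ℝ] ℂ →L[ℝ] ℝ) (z : ℂ) :
    B z z + B (z * Complex.I) (z * Complex.I) = ‖z‖ ^ 2 * (B 1 1 + B Complex.I Complex.I) := by
  have hz : z = z.re • (1 : ℂ) + z.im • Complex.I := by simp
  have hzI : z * Complex.I = (-z.im) • (1 : ℂ) + z.re • Complex.I := by
    apply Complex.ext <;> simp
  rw [hzI, Complex.sq_norm, Complex.normSq_apply]
  conv_lhs => rw [hz]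
  simp only [map_add, map_smul, add_apply, smul_apply, smul_eq_mul]
  simp only [Complex.real_smul, mul_one, Complex.re_add_im, neg_mul]
  ring

/-- Polar coordinates of the Euclidean plane with logarithmic radius: the point with `log |z| = ρ`
and argument `θ`. They are conformal, so Laplacians take their simplest form in them. -/
noncomputable def logPolar (ρ θ : ℝ) : ℂ := Complex.exp (ρ + θ * Complex.I)

theorem norm_logPolar (ρ θ : ℝ) : ‖logPolar ρ θ‖ = exp ρ := by simp [logPolar, Complex.norm_exp]

theorem logPolar_ne_zero (ρ θ : ℝ) : logPolar ρ θ ≠ 0 := Complex.exp_ne_zero _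

theorem logPolar_eq_mul (ρ θ : ℝ) : logPolar ρ θ = exp ρ * Complex.exp (θ * Complex.I) := by
  rw [logPolar, Complex.exp_add, Complex.ofReal_exp]

theorem exp_mul_I_mul_logPolar (s ρ θ : ℝ) :
    Complex.exp (s * Complex.I) * logPolar ρ θ = logPolar ρ (s + θ) := by
  rw [logPolar, logPolar, ← Complex.exp_add]
  push_cast
  ring_nf

theorem logPolar_log_norm_arg {z : ℂ} (hz : z ≠ 0) : logPolar (log ‖z‖) z.arg = z := by
  rw [logPolar_eq_mul, exp_log (norm_pos_iff.2 hz), Complex.norm_mul_exp_arg_mul_I]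

theorem hasDerivAt_logPolar_left (ρ θ : ℝ) :
    HasDerivAt (fun s => logPolar s θ) (logPolar ρ θ) ρ :=
  (((hasDerivAt_id ρ).ofReal_comp.add_const (θ * Complex.I)).cexp).congr_deriv (by simp [logPolar])

theorem hasDerivAt_logPolar_right (ρ θ : ℝ) :
    HasDerivAt (logPolar ρ) (logPolar ρ θ * Complex.I) θ :=
  ((((hasDerivAt_id θ).ofReal_comp.mul_const Complex.I).const_add (ρ : ℂ)).cexp).congr_deriv
    (by simp [logPolar])

theorem deriv_deriv_logPolar_add_deriv_deriv {u : ℂ → ℝ} {ρ θ : ℝ}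
    (hu : ContDiffAt ℝ 2 u (logPolar ρ θ)) :
    deriv (deriv fun s => u (logPolar s θ)) ρ + deriv (deriv fun t => u (logPolar ρ t)) θ
      = exp ρ ^ 2 * Laplacian.laplacian u (logPolar ρ θ) := by
  have hρ := hasDerivAt_deriv_comp (γ := fun s => logPolar s θ) (γ' := fun s => logPolar s θ) hu
    (fun s => hasDerivAt_logPolar_left s θ) (hasDerivAt_logPolar_left ρ θ)
  have hθ := hasDerivAt_deriv_comp hu (hasDerivAt_logPolar_right ρ)
    ((hasDerivAt_logPolar_right ρ θ).mul_const Complex.I)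
  have htrace := apply_self_add_apply_mul_I (fderiv ℝ (fderiv ℝ u) (logPolar ρ θ)) (logPolar ρ θ)
  rw [hρ.deriv, hθ.deriv, InnerProductSpace.laplacian_eq_iteratedFDeriv_complexPlane,
    mul_assoc, Complex.I_mul_I, mul_neg_one, map_neg]
  rw [norm_logPolar] at htrace
  simp only [iteratedFDeriv_two_apply, Matrix.cons_val_zero, Matrix.cons_val_one]
  linear_combination htrace

theorem contDiffAt_exp_of_comp_exp {E : Type*} [NormedAddCommGroup E] [NormedSpace ℝ E]
    {u : ℂ → E} {n : WithTop ℕ∞} {ζ : ℂ} (h : ContDiffAt ℝ n (fun ξ => u (Complex.exp ξ)) ζ) :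
    ContDiffAt ℝ n u (Complex.exp ζ) := by
  -- the branch of the logarithm near `exp ζ` that takes the value `ζ` there
  let L : ℂ → ℂ := fun z => Complex.log (z / Complex.exp ζ) + ζ
  have hLζ : L (Complex.exp ζ) = ζ := by simp [L]
  have hL : ContDiffAt ℝ n L (Complex.exp ζ) :=
    (((Complex.contDiffAt_log (by simp)).comp (Complex.exp ζ)
      (contDiffAt_id.div_const (Complex.exp ζ))).add contDiffAt_const).restrict_scalars ℝ
  refine (ContDiffAt.comp (Complex.exp ζ) (hLζ.symm ▸ h) hL).congr_of_eventuallyEq ?_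
  filter_upwards [isOpen_ne.mem_nhds (Complex.exp_ne_zero ζ)] with z hz
  simp only [Function.comp_apply, L]
  rw [Complex.exp_add, Complex.exp_log (div_ne_zero hz (Complex.exp_ne_zero ζ)),
    div_mul_cancel₀ _ (Complex.exp_ne_zero ζ)]

theorem conformalFactor_logPolar (ρ θ : ℝ) :
    conformalFactor (logPolar ρ θ) = -(exp ρ * sinh ρ)⁻¹ := by
  have hprod : exp ρ * sinh ρ = (exp ρ ^ 2 - 1) / 2 := by
    rw [sinh_eq, exp_neg]
    field_simp
  rw [conformalFactor, norm_logPolar, hprod, inv_div, ← div_neg, neg_sub]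

theorem hypLaplacian_logPolar {u : ℂ → ℝ} {ρ θ : ℝ} (hu : ContDiffAt ℝ 2 u (logPolar ρ θ)) :
    hypLaplacian u (logPolar ρ θ) = sinh ρ ^ 2 *
      (deriv (deriv fun s => u (logPolar s θ)) ρ + deriv (deriv fun t => u (logPolar ρ t)) θ) := by
  rw [deriv_deriv_logPolar_add_deriv_deriv hu, hypLaplacian, conformalFactor_logPolar]
  simp only [inv_pow, neg_sq, inv_inv]
  ring

/-- The geodesic radius `r` of a point of the hyperbolic plane as a function of its logarithmic
Euclidean radius `ρ = log tanh (r / 2)`; only `ρ < 0` is meaningful. -/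
noncomputable def geodesicRadius (ρ : ℝ) : ℝ := 2 * artanh (exp ρ)

theorem tanh_half_pos {r : ℝ} (hr : 0 < r) : 0 < tanh (r / 2) := by
  rw [tanh_eq_sinh_div_cosh]
  exact div_pos (sinh_pos_iff.2 (half_pos hr)) (cosh_pos _)

theorem polar_eq_logPolar {r : ℝ} (hr : 0 < r) (θ : ℝ) :
    polar r θ = logPolar (log (tanh (r / 2))) θ := by
  rw [polar, logPolar_eq_mul, exp_log (tanh_half_pos hr)]

theorem geodesicRadius_log_tanh_half {r : ℝ} (hr : 0 < r) :
    geodesicRadius (log (tanh (r / 2))) = r := by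
  rw [geodesicRadius, exp_log (tanh_half_pos hr), artanh_tanh, mul_div_cancel₀ _ two_ne_zero]

section NegRadius

variable {ρ : ℝ} (hρ : ρ < 0)
include hρ

theorem geodesicRadius_pos : 0 < geodesicRadius ρ :=
  mul_pos two_pos (artanh_pos ⟨exp_pos ρ, exp_lt_one_iff.2 hρ⟩)

theorem tanh_half_geodesicRadius : tanh (geodesicRadius ρ / 2) = exp ρ := by
  rw [geodesicRadius, mul_div_cancel_left₀ _ two_ne_zero]
  exact tanh_artanh ⟨neg_one_lt_zero.trans (exp_pos ρ), exp_lt_one_iff.2 hρ⟩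

theorem polar_geodesicRadius (θ : ℝ) : polar (geodesicRadius ρ) θ = logPolar ρ θ := by
  rw [polar, tanh_half_geodesicRadius hρ, logPolar_eq_mul]

theorem inv_sinh_geodesicRadius : (sinh (geodesicRadius ρ))⁻¹ = -sinh ρ := by
  have htanh := tanh_half_geodesicRadius hρ
  have hsinh : sinh (geodesicRadius ρ / 2) ≠ 0 :=
    (sinh_pos_iff.2 (half_pos (geodesicRadius_pos hρ))).ne'
  have hcosh := (cosh_pos (geodesicRadius ρ / 2)).ne'
  have hsq := cosh_sq (geodesicRadius ρ / 2)
  have hdouble := sinh_two_mul (geodesicRadius ρ / 2)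
  rw [mul_div_cancel₀ _ two_ne_zero] at hdouble
  rw [hdouble, sinh_eq ρ, exp_neg, ← htanh, tanh_eq_sinh_div_cosh]
  field_simp
  linarith

end NegRadius

/-- The values of `ρ = log |z|` on a rotationally symmetric domain. -/
def logRadii (Ω : Set ℂ) : Set ℝ := {ρ | logPolar ρ 0 ∈ Ω}

namespace IsRotSymmDomain

variable {Ω : Set ℂ} (hΩ : IsRotSymmDomain Ω)
include hΩ

theorem logPolar_mem_iff {ρ θ : ℝ} : logPolar ρ θ ∈ Ω ↔ ρ ∈ logRadii Ω := by
  constructor <;> intro h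
  · simpa only [exp_mul_I_mul_logPolar, neg_add_cancel, logRadii, mem_ofPred_eq]
      using hΩ.rot_mem _ h (-θ)
  · simpa only [exp_mul_I_mul_logPolar, add_zero] using hΩ.rot_mem _ h θ

theorem logPolar_mem_sdiff {ρ : ℝ} (hρ : ρ ∈ logRadii Ω) (θ : ℝ) : logPolar ρ θ ∈ Ω \ {0} :=
  ⟨hΩ.logPolar_mem_iff.2 hρ, logPolar_ne_zero ρ θ⟩

theorem exists_logPolar_eq {z : ℂ} (hz : z ∈ Ω \ {0}) :
    ∃ ρ ∈ logRadii Ω, ∃ θ, logPolar ρ θ = z := by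
  have heq := logPolar_log_norm_arg hz.2
  exact ⟨log ‖z‖, hΩ.logPolar_mem_iff.1 (heq.symm ▸ hz.1), z.arg, heq⟩

theorem neg_of_mem_logRadii {ρ : ℝ} (hρ : ρ ∈ logRadii Ω) : ρ < 0 := by
  simpa [norm_logPolar] using hΩ.subset_disc hρ

theorem isOpen_sdiff_zero : IsOpen (Ω \ {0}) := hΩ.isOpen.sdiff isClosed_singleton

theorem isOpen_logRadii : IsOpen (logRadii Ω) :=
  hΩ.isOpen.preimage (continuous_iff_continuousAt.2 fun ρ =>
    (hasDerivAt_logPolar_left ρ 0).continuousAt)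

theorem isPreconnected_logRadii : IsPreconnected (logRadii Ω) := by
  have hnorm : ∀ ρ, exp ρ ∈ norm '' Ω ↔ ρ ∈ logRadii Ω := fun ρ => by
    refine ⟨?_, fun hρ => ⟨_, hρ, norm_logPolar ρ 0⟩⟩
    rintro ⟨z, hz, hzρ⟩
    have hz0 : z ≠ 0 := norm_ne_zero_iff.1 (hzρ ▸ (exp_pos ρ).ne')
    refine hΩ.logPolar_mem_iff (θ := z.arg).1 ?_
    rwa [← log_exp ρ, ← hzρ, logPolar_log_norm_arg hz0]
  have himage := hΩ.isConnected.isPreconnected.image _ continuous_norm.continuousOn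
  rw [isPreconnected_iff_ordConnected] at himage ⊢
  refine ⟨fun a ha b hb c hc => ?_⟩
  rw [← hnorm] at ha hb ⊢
  exact himage.out ha hb ⟨exp_le_exp.2 hc.1, exp_le_exp.2 hc.2⟩

theorem nonempty_logRadii : (logRadii Ω).Nonempty := by
  obtain ⟨z, hz⟩ := (dense_compl_singleton (0 : ℂ)).inter_open_nonempty Ω hΩ.isOpen
    hΩ.isConnected.nonempty
  obtain ⟨ρ, hρ, -⟩ := hΩ.exists_logPolar_eq hz
  exact ⟨ρ, hρ⟩

theorem forall_polar_iff {u : ℂ → ℝ} {f : ℝ → ℝ → ℝ} :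
    (∀ r θ, 0 < r → polar r θ ∈ Ω → u (polar r θ) = f r θ) ↔
      ∀ ρ ∈ logRadii Ω, ∀ θ, u (logPolar ρ θ) = f (geodesicRadius ρ) θ := by
  constructor
  · intro h ρ hρ θ
    have hρ0 := hΩ.neg_of_mem_logRadii hρ
    rw [← polar_geodesicRadius hρ0 θ]
    refine h _ θ (geodesicRadius_pos hρ0) ?_
    rwa [polar_geodesicRadius hρ0, hΩ.logPolar_mem_iff]
  · intro h r θ hr hmem
    rw [polar_eq_logPolar hr, hΩ.logPolar_mem_iff] at hmem
    rw [polar_eq_logPolar hr, h _ hmem, geodesicRadius_log_tanh_half hr]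

theorem exists_forall_polar_mem : ∃ r, 0 < r ∧ ∀ θ, polar r θ ∈ Ω \ {0} := by
  obtain ⟨ρ, hρ⟩ := hΩ.nonempty_logRadii
  have hρ0 := hΩ.neg_of_mem_logRadii hρ
  refine ⟨geodesicRadius ρ, geodesicRadius_pos hρ0, fun θ => ?_⟩
  rw [polar_geodesicRadius hρ0]
  exact hΩ.logPolar_mem_sdiff hρ θ

end IsRotSymmDomain

/-- `u = H(ρ) w(θ)` on `Ω` in the coordinates `(ρ, θ)`. -/
def IsSeparated (Ω : Set ℂ) (u : ℂ → ℝ) (H w : ℝ → ℝ) : Prop :=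
  ∀ ρ ∈ logRadii Ω, ∀ θ, u (logPolar ρ θ) = H ρ * w θ

namespace IsSeparated

variable {Ω : Set ℂ} {u : ℂ → ℝ} {H w : ℝ → ℝ}

theorem contDiff_right (h : IsSeparated Ω u H w) (hΩ : IsRotSymmDomain Ω)
    (hu : ContDiffOn ℝ 2 u (Ω \ {0})) {ρ : ℝ} (hρ : ρ ∈ logRadii Ω) (hH : H ρ ≠ 0) :
    ContDiff ℝ 2 w := by
  have hw : w = fun θ => u (logPolar ρ θ) / H ρ :=
    funext fun θ => eq_div_of_mul_eq hH ((mul_comm _ _).trans (h ρ hρ θ).symm)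
  have hpolar : ContDiff ℝ 2 fun θ : ℝ => logPolar ρ θ :=
    (contDiff_const.add (Complex.ofRealCLM.contDiff.mul contDiff_const)).cexp
  rw [hw, ← contDiffOn_univ]
  exact (hu.comp hpolar.contDiffOn fun θ _ => hΩ.logPolar_mem_sdiff hρ θ).div_const _

theorem contDiffOn_left (h : IsSeparated Ω u H w) (hΩ : IsRotSymmDomain Ω)
    (hu : ContDiffOn ℝ 2 u (Ω \ {0})) {θ : ℝ} (hw : w θ ≠ 0) : ContDiffOn ℝ 2 H (logRadii Ω) := by
  have hpolar : ContDiff ℝ 2 fun ρ : ℝ => logPolar ρ θ :=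
    (Complex.ofRealCLM.contDiff.add contDiff_const).cexp
  exact ((hu.comp hpolar.contDiffOn fun ρ hρ => hΩ.logPolar_mem_sdiff hρ θ).div_const (w θ)).congr
    fun ρ hρ => eq_div_of_mul_eq hw (h ρ hρ θ).symm

theorem contDiffOn (h : IsSeparated Ω u H w) (hΩ : IsRotSymmDomain Ω)
    (hH : ContDiffOn ℝ 2 H (logRadii Ω)) (hw : ContDiff ℝ 2 w) : ContDiffOn ℝ 2 u (Ω \ {0}) := by
  rintro z hz
  obtain ⟨ρ, hρ, θ, rfl⟩ := hΩ.exists_logPolar_eq hz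
  refine (contDiffAt_exp_of_comp_exp ?_).contDiffWithinAt
  set ζ : ℂ := ρ + θ * Complex.I with hζ
  have hre : ζ.re ∈ logRadii Ω := by simpa [hζ] using hρ
  have hfactors : ContDiffAt ℝ 2 (fun ξ : ℂ => H ξ.re * w ξ.im) ζ :=
    ((hH.contDiffAt (hΩ.isOpen_logRadii.mem_nhds hre)).comp ζ
      Complex.reCLM.contDiff.contDiffAt).mul (hw.comp Complex.imCLM.contDiff).contDiffAt
  have hmem : ∀ᶠ ξ : ℂ in 𝓝 ζ, ξ.re ∈ logRadii Ω :=
    Complex.continuous_re.continuousAt.eventually (hΩ.isOpen_logRadii.eventually_mem hre)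
  refine hfactors.congr_of_eventuallyEq (hmem.mono fun ξ hξ => ?_)
  simp only [← h _ hξ, logPolar, Complex.re_add_im]

theorem hypLaplacian_logPolar (h : IsSeparated Ω u H w) (hΩ : IsRotSymmDomain Ω)
    (hu : ContDiffOn ℝ 2 u (Ω \ {0})) {ρ : ℝ} (hρ : ρ ∈ logRadii Ω) (θ : ℝ) :
    hypLaplacian u (logPolar ρ θ) =
      sinh ρ ^ 2 * (deriv (deriv H) ρ * w θ + H ρ * deriv (deriv w) θ) := by
  have hmem := hΩ.logPolar_mem_sdiff hρ θ
  have hradial : (fun s => u (logPolar s θ)) =ᶠ[𝓝 ρ] fun s => H s * w θ :=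
    (hΩ.isOpen_logRadii.eventually_mem hρ).mono fun s hs => h s hs θ
  have hangular : (fun t => u (logPolar ρ t)) = fun t => H ρ * w t := funext (h ρ hρ)
  rw [HypPlane.hypLaplacian_logPolar
    (hu.contDiffAt (hΩ.isOpen_sdiff_zero.mem_nhds hmem)), hradial.deriv.deriv_eq, hangular]
  simp only [deriv_mul_const_field', deriv_const_mul_field']

theorem isSolution_iff (h : IsSeparated Ω u H w) (hΩ : IsRotSymmDomain Ω) {F : ℝ → ℝ} :
    IsSolution Ω F u ↔ ContDiffOn ℝ 2 u (Ω \ {0}) ∧ ∀ ρ ∈ logRadii Ω, ∀ θ,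
      sinh ρ ^ 2 * (deriv (deriv H) ρ * w θ + H ρ * deriv (deriv w) θ) = F (H ρ * w θ) := by
  refine and_congr_right fun hu => ⟨fun heq ρ hρ θ => ?_, fun heq z hz => ?_⟩
  · rw [← h.hypLaplacian_logPolar hΩ hu hρ, heq _ (hΩ.logPolar_mem_sdiff hρ θ), h ρ hρ]
  · obtain ⟨ρ, hρ, θ, rfl⟩ := hΩ.exists_logPolar_eq hz
    rw [h.hypLaplacian_logPolar hΩ hu hρ, heq ρ hρ, h ρ hρ]

end IsSeparated

/-! ### Separation of variables -/

theorem exists_abs_ne_abs {X : Type*} [TopologicalSpace X] [PreconnectedSpace X] {w : X → ℝ}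
    (hw : Continuous w) {s t : X} (hst : w s ≠ w t) : ∃ x y, w x ≠ 0 ∧ w y ≠ 0 ∧ |w x| ≠ |w y| := by
  by_contra! habs
  obtain ⟨x, hx⟩ : ∃ x, w x ≠ 0 := by
    by_contra! hzero
    exact hst ((hzero s).trans (hzero t).symm)
  have hfin : ({0, w x, -w x} : Set ℝ).Finite := by simp
  refine hst (isPreconnected_univ.constant_of_mapsTo hfin.isDiscrete hw.continuousOn
    (fun y _ => ?_) (mem_univ s) (mem_univ t))
  by_cases hy : w y = 0
  · simp [hy]
  · rcases abs_eq_abs.1 (habs y x hy hx) with h | h <;> simp [h]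

theorem exists_eq_const_mul_of_sq_eq {X : Type*} [TopologicalSpace X] {I : Set X} {f g : X → ℝ}
    {K : ℝ} (hI : IsPreconnected I) (hf : ContinuousOn f I) (hg : ContinuousOn g I)
    (hg0 : ∀ x ∈ I, g x ≠ 0) (hsq : ∀ x ∈ I, f x ≠ 0 → f x ^ 2 = K * g x ^ 2) {x₀ : X}
    (hx₀ : x₀ ∈ I) (hfx₀ : f x₀ ≠ 0) :
    ∃ D, D ≠ 0 ∧ K = D ^ 2 ∧ ∀ x ∈ I, f x = D * g x := by
  have hratio : ∀ x ∈ I, f x ≠ 0 → (f x / g x) ^ 2 = K := fun x hx h0 => by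
    rw [div_pow, hsq x hx h0, mul_div_cancel_right₀ _ (pow_ne_zero 2 (hg0 x hx))]
  have hK := (hratio x₀ hx₀ hfx₀).symm
  refine ⟨f x₀ / g x₀, div_ne_zero hfx₀ (hg0 x₀ hx₀), hK, fun x hx => ?_⟩
  have hfin : ({0, f x₀ / g x₀, -(f x₀ / g x₀)} : Set ℝ).Finite := by simp
  have hmaps : MapsTo (fun x => f x / g x) I {0, f x₀ / g x₀, -(f x₀ / g x₀)} := fun x hx => by
    by_cases h0 : f x = 0
    · simp [h0]
    · rcases sq_eq_sq_iff_eq_or_eq_neg.1 ((hratio x hx h0).trans hK) with h | h <;> simp [h]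
  exact (div_eq_iff (hg0 x hx)).1
    (hI.constant_of_mapsTo hfin.isDiscrete (hf.div hg hg0) hmaps hx hx₀)

theorem mul_mul_abs_rpow (a b p : ℝ) :
    a * b * |a * b| ^ p = a * |a| ^ p * (b * |b| ^ p) := by
  rw [abs_mul, mul_rpow (abs_nonneg _) (abs_nonneg _)]
  ring

theorem mul_abs_rpow_two (a : ℝ) : a * |a| ^ (2 : ℝ) = a ^ 3 := by
  rw [rpow_two, sq_abs]
  ring

theorem coefficients_eq {X : Type*} {w g : X → ℝ} {A A' B B' p : ℝ} {x y : X} (hp : p ≠ 0)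
    (hx : w x ≠ 0) (hy : w y ≠ 0) (hxy : |w x| ≠ |w y|)
    (h : ∀ θ, A * w θ + g θ = B * (w θ * |w θ| ^ p))
    (h' : ∀ θ, A' * w θ + g θ = B' * (w θ * |w θ| ^ p)) : A = A' ∧ B = B' := by
  have hdiff : ∀ θ, w θ ≠ 0 → A - A' = (B - B') * |w θ| ^ p := fun θ hθ =>
    mul_left_cancel₀ hθ (by linear_combination h θ - h' θ)
  have hpow : |w x| ^ p ≠ |w y| ^ p := fun e =>
    hxy ((rpow_left_inj (abs_nonneg _) (abs_nonneg _) hp).1 e)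
  have hB : B - B' = 0 :=
    (mul_eq_zero.1 (by linear_combination hdiff y hy - hdiff x hx :
      (B - B') * (|w x| ^ p - |w y| ^ p) = 0)).resolve_right (sub_ne_zero.2 hpow)
  exact ⟨sub_eq_zero.1 (by rw [hdiff x hx, hB, zero_mul]), sub_eq_zero.1 hB⟩

theorem exists_separation_constants {X Y : Type*} [TopologicalSpace Y] [PreconnectedSpace Y]
    {I : Set X} {H H₂ σ : X → ℝ} {w w₂ : Y → ℝ} {ε p : ℝ} (hε : ε ≠ 0) (hp : p ≠ 0)
    (hσ : ∀ ρ ∈ I, σ ρ ≠ 0) (hw : Continuous w) {s t : Y} (hst : w s ≠ w t)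
    (heq : ∀ ρ ∈ I, ∀ θ, σ ρ * (H₂ ρ * w θ + H ρ * w₂ θ) =
      ε * (H ρ * w θ * |H ρ * w θ| ^ p)) {ρ₀ : X} (hρ₀ : ρ₀ ∈ I) (hHρ₀ : H ρ₀ ≠ 0) :
    ∃ A K, (∀ ρ ∈ I, H ρ ≠ 0 → H₂ ρ = A * H ρ ∧ |H ρ| ^ p = K * σ ρ) ∧
      ∀ θ, A * w θ + w₂ θ = ε * K * (w θ * |w θ| ^ p) := by
  obtain ⟨x, y, hx, hy, hxy⟩ := exists_abs_ne_abs hw hst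
  have hangular : ∀ ρ ∈ I, H ρ ≠ 0 → ∀ θ,
      H₂ ρ / H ρ * w θ + w₂ θ = ε * (|H ρ| ^ p / σ ρ) * (w θ * |w θ| ^ p) := by
    intro ρ hρ h0 θ
    have hσρ := hσ ρ hρ
    have hmul := heq ρ hρ θ
    rw [mul_mul_abs_rpow] at hmul
    field_simp
    linear_combination hmul
  refine ⟨H₂ ρ₀ / H ρ₀, |H ρ₀| ^ p / σ ρ₀, fun ρ hρ h0 => ?_, hangular ρ₀ hρ₀ hHρ₀⟩
  obtain ⟨hA, hK⟩ :=
    coefficients_eq hp hx hy hxy (hangular ρ hρ h0) (hangular ρ₀ hρ₀ hHρ₀)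
  exact ⟨(div_eq_iff h0).1 hA, (div_eq_iff (hσ ρ hρ)).1 (mul_left_cancel₀ hε hK)⟩

theorem deriv_mul_sinh_eq_of_abs_rpow_eq {H : ℝ → ℝ} {p K ρ : ℝ} (hp : p ≠ 0)
    (hd : DifferentiableAt ℝ H ρ) (hρ : ρ ≠ 0) (h0 : H ρ ≠ 0)
    (hK : ∀ᶠ x in 𝓝 ρ, |H x| ^ p = K * sinh x ^ 2) :
    deriv H ρ * sinh ρ = 2 / p * (cosh ρ * H ρ) := by
  have hs : sinh ρ ≠ 0 := sinh_ne_zero.2 hρ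
  have hK0 : K ≠ 0 := fun h => (rpow_pos_of_pos (abs_pos.2 h0) p).ne' (by simp [hK.self_of_nhds, h])
  have hlog : ∀ᶠ x in 𝓝 ρ, p * log (H x) = log K + 2 * log (sinh x) := by
    filter_upwards [hK, hd.continuousAt.eventually_ne h0,
      continuous_sinh.continuousAt.eventually_ne hs] with x hx hHx hsx
    have hlogx := congrArg log hx
    rw [log_rpow (abs_pos.2 hHx), log_abs, log_mul hK0 (pow_ne_zero 2 hsx), log_pow] at hlogx
    exact_mod_cast hlogx
  have hderiv := ((hd.hasDerivAt.log h0).const_mul p).unique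
    ((((hasDerivAt_sinh ρ).log hs).const_mul 2).const_add (log K) |>.congr_of_eventuallyEq hlog)
  field_simp at hderiv ⊢
  linear_combination hderiv

theorem riccati_of_deriv_mul_sinh_eq {H : ℝ → ℝ} {A m ρ : ℝ} (hd : DifferentiableAt ℝ H ρ)
    (hdd : HasDerivAt (deriv H) (A * H ρ) ρ) (h0 : H ρ ≠ 0)
    (h : ∀ᶠ x in 𝓝 ρ, deriv H x * sinh x = m * (cosh x * H x)) :
    (A - m ^ 2) * sinh ρ ^ 2 = m ^ 2 - m := by
  have hderiv := (hdd.fun_mul (hasDerivAt_sinh ρ)).unique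
    (((hasDerivAt_cosh ρ).fun_mul hd.hasDerivAt).const_mul m |>.congr_of_eventuallyEq h)
  refine mul_left_cancel₀ h0 ?_
  linear_combination sinh ρ * hderiv + (m * cosh ρ - cosh ρ) * h.self_of_nhds
    + (m ^ 2 - m) * H ρ * cosh_sq ρ

theorem eq_zero_of_eventually_mul_sinh_sq_eq {a b ρ : ℝ} (hρ : ρ ≠ 0)
    (h : ∀ᶠ x in 𝓝 ρ, a * sinh x ^ 2 = b) : a = 0 ∧ b = 0 := by
  have hderiv := (((hasDerivAt_sinh ρ).fun_pow 2).const_mul a).unique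
    ((hasDerivAt_const ρ b).congr_of_eventuallyEq h)
  have ha : a = 0 := by simpa [hρ, (cosh_pos ρ).ne'] using hderiv
  exact ⟨ha, by simpa [ha] using h.self_of_nhds.symm⟩

-- With `m = 2 / p`, the hypothesis `hK` gives `H' / H = m coth ρ`, and then `H'' = A H` becomes the
-- Riccati relation `(A - m²) sinh² ρ = m² - m`.
theorem exponent_eq_two {N : Set ℝ} (hN : IsOpen N) (hN0 : ∀ ρ ∈ N, ρ ≠ 0) {H : ℝ → ℝ}
    (hH : ContDiffOn ℝ 2 H N) (h0 : ∀ ρ ∈ N, H ρ ≠ 0) {p A K : ℝ} (hp : p ≠ 0)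
    (hA : ∀ ρ ∈ N, deriv (deriv H) ρ = A * H ρ) (hK : ∀ ρ ∈ N, |H ρ| ^ p = K * sinh ρ ^ 2)
    (hne : N.Nonempty) : p = 2 ∧ A = 1 := by
  obtain ⟨ρ₀, hρ₀⟩ := hne
  have hd : ∀ ρ ∈ N, DifferentiableAt ℝ H ρ := fun ρ hρ =>
    (hH.contDiffAt (hN.mem_nhds hρ)).differentiableAt two_ne_zero
  have hdd : ∀ ρ ∈ N, HasDerivAt (deriv H) (A * H ρ) ρ := fun ρ hρ => by
    rw [← hA ρ hρ]
    exact (((hH.deriv_of_isOpen hN (m := 1) le_rfl).contDiffAt (hN.mem_nhds hρ)).differentiableAt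
      one_ne_zero).hasDerivAt
  have hlogDeriv : ∀ ρ ∈ N, deriv H ρ * sinh ρ = 2 / p * (cosh ρ * H ρ) := fun ρ hρ =>
    deriv_mul_sinh_eq_of_abs_rpow_eq hp (hd ρ hρ) (hN0 ρ hρ) (h0 ρ hρ)
      ((hN.eventually_mem hρ).mono hK)
  have hriccati : ∀ ρ ∈ N, (A - (2 / p) ^ 2) * sinh ρ ^ 2 = (2 / p) ^ 2 - 2 / p := fun ρ hρ =>
    riccati_of_deriv_mul_sinh_eq (hd ρ hρ) (hdd ρ hρ) (h0 ρ hρ)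
      ((hN.eventually_mem hρ).mono hlogDeriv)
  obtain ⟨hAm, hm⟩ := eq_zero_of_eventually_mul_sinh_sq_eq (hN0 ρ₀ hρ₀)
    ((hN.eventually_mem hρ₀).mono hriccati)
  have hp2 : p = 2 := by
    field_simp at hm
    linarith
  subst hp2
  exact ⟨rfl, by linarith⟩

namespace IsSeparated

variable {Ω : Set ℂ} {u : ℂ → ℝ} {H w : ℝ → ℝ} {ε q : ℝ}

theorem exists_isDuffing (h : IsSeparated Ω u H w) (hΩ : IsRotSymmDomain Ω) (hε : ε ≠ 0)
    (hq : q ≠ 1) (hu : IsSolution Ω (fun s => ε * (s * |s| ^ (q - 1))) u) {ρ₀ : ℝ}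
    (hρ₀ : ρ₀ ∈ logRadii Ω) (hHρ₀ : H ρ₀ ≠ 0) {s t : ℝ} (hst : w s ≠ w t) :
    q = 3 ∧ ∃ C, C ≠ 0 ∧ (∀ ρ ∈ logRadii Ω, H ρ = C * -sinh ρ) ∧
      IsDuffing ε fun θ => C * w θ := by
  obtain ⟨hsmooth, heq⟩ := (h.isSolution_iff hΩ).1 hu
  have hw := h.contDiff_right hΩ hsmooth hρ₀ hHρ₀
  obtain ⟨θ₀, -, hθ₀, -⟩ := exists_abs_ne_abs hw.continuous hst
  have hH := h.contDiffOn_left hΩ hsmooth hθ₀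
  have hρne : ∀ ρ ∈ logRadii Ω, ρ ≠ 0 := fun ρ hρ => (hΩ.neg_of_mem_logRadii hρ).ne
  have hsinh : ∀ ρ ∈ logRadii Ω, sinh ρ ≠ 0 := fun ρ hρ => sinh_ne_zero.2 (hρne ρ hρ)
  obtain ⟨A, K, hradial, hangular⟩ := exists_separation_constants hε (sub_ne_zero.2 hq)
    (fun ρ hρ => pow_ne_zero 2 (hsinh ρ hρ)) hw.continuous hst heq hρ₀ hHρ₀
  obtain ⟨hp, rfl⟩ := exponent_eq_two
    (hH.continuousOn.isOpen_inter_preimage hΩ.isOpen_logRadii isOpen_ne)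
    (fun ρ hρ => hρne ρ hρ.1) (hH.mono inter_subset_left) (fun ρ hρ => hρ.2) (sub_ne_zero.2 hq)
    (fun ρ hρ => (hradial ρ hρ.1 hρ.2).1) (fun ρ hρ => (hradial ρ hρ.1 hρ.2).2) ⟨ρ₀, hρ₀, hHρ₀⟩
  simp only [hp, rpow_two, sq_abs] at hradial hangular
  obtain ⟨C, hC, rfl, hHC⟩ := exists_eq_const_mul_of_sq_eq (g := fun ρ => -sinh ρ) (K := K)
    hΩ.isPreconnected_logRadii hH.continuousOn continuous_sinh.neg.continuousOn
    (fun ρ hρ => neg_ne_zero.2 (hsinh ρ hρ))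
    (fun ρ hρ h0 => by rw [neg_sq]; exact (hradial ρ hρ h0).2) hρ₀ hHρ₀
  refine ⟨by linarith, C, hC, hHC, contDiff_const.mul hw, fun θ => ?_⟩
  simp only [deriv_const_mul_field']
  linear_combination C * hangular θ

theorem isSolution_of_isDuffing {v : ℝ → ℝ} (h : IsSeparated Ω u (fun ρ => -sinh ρ) v)
    (hΩ : IsRotSymmDomain Ω) (hv : IsDuffing ε v) : IsSolution Ω (fun s => ε * s ^ 3) u := by
  refine (h.isSolution_iff hΩ).2
    ⟨h.contDiffOn hΩ contDiff_sinh.neg.contDiffOn hv.1, fun ρ _ θ => ?_⟩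
  have hsinh : deriv (deriv fun ρ => -sinh ρ) ρ = -sinh ρ := by simp
  rw [hsinh]
  linear_combination -sinh ρ ^ 3 * hv.2 θ

end IsSeparated

section RotSymm

variable {Ω : Set ℂ} (hΩ : IsRotSymmDomain Ω) {ε q : ℝ} {u : ℂ → ℝ}
include hΩ

theorem exists_isDuffing_of_not_isRadial (hε : ε ≠ 0) (hq : q ≠ 1)
    (hu : IsSolution Ω (fun s => ε * (s * |s| ^ (q - 1))) u) (hps : IsPseudoRadial Ω u)
    (hnr : ¬ IsRadial Ω u) :
    q = 3 ∧ ∃ v, IsDuffing ε v ∧ Function.Periodic v (2 * π) ∧ (∃ s t, v s ≠ v t) ∧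
      ∀ r θ, 0 < r → polar r θ ∈ Ω → u (polar r θ) = v θ / sinh r := by
  obtain ⟨h, w, hper, huw⟩ := hps
  have hsep : IsSeparated Ω u (fun ρ => h (geodesicRadius ρ)) w := hΩ.forall_polar_iff.1 huw
  obtain ⟨s, t, hst⟩ : ∃ s t, w s ≠ w t := by
    by_contra! hconst
    exact hnr ⟨fun r => h r * w 0, fun r θ hr hm => by rw [huw r θ hr hm, hconst θ 0]⟩
  obtain ⟨ρ₀, hρ₀, hhρ₀⟩ : ∃ ρ ∈ logRadii Ω, h (geodesicRadius ρ) ≠ 0 := by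
    by_contra! hzero
    exact hnr ⟨0, hΩ.forall_polar_iff.2 fun ρ hρ θ => by
      simp only [hsep ρ hρ, hzero ρ hρ, zero_mul, Pi.zero_apply]⟩
  obtain ⟨hq3, C, hC, hhC, hv⟩ := hsep.exists_isDuffing hΩ hε hq hu hρ₀ hhρ₀ hst
  refine ⟨hq3, _, hv, fun θ => congrArg (C * ·) (hper θ),
    ⟨s, t, fun e => hst (mul_left_cancel₀ hC e)⟩, hΩ.forall_polar_iff.2 fun ρ hρ θ => ?_⟩
  simp only [hsep ρ hρ, hhC ρ hρ, div_eq_mul_inv,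
    inv_sinh_geodesicRadius (hΩ.neg_of_mem_logRadii hρ)]
  ring

theorem isRadial_of_isPseudoRadial (hε : ε ≠ 0) (hq : q ≠ 1) (hεq : 0 < ε ∨ q ≠ 3)
    (hu : IsSolution Ω (fun s => ε * (s * |s| ^ (q - 1))) u) (hps : IsPseudoRadial Ω u) :
    IsRadial Ω u := by
  by_contra hnr
  obtain ⟨hq3, v, hv, hper, ⟨s, t, hst⟩, -⟩ :=
    exists_isDuffing_of_not_isRadial hΩ hε hq hu hps hnr
  exact hst (hv.eq_of_periodic_of_pos (hεq.resolve_right (not_not.2 hq3)) hper s t)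

theorem isSolution_cubic_of_isDuffing {v : ℝ → ℝ} (hv : IsDuffing ε v)
    (huv : ∀ r θ, 0 < r → polar r θ ∈ Ω → u (polar r θ) = v θ / sinh r) :
    IsSolution Ω (fun s => ε * s ^ 3) u := by
  have hsep : IsSeparated Ω u (fun ρ => -sinh ρ) v := fun ρ hρ θ => by
    rw [hΩ.forall_polar_iff.1 huv ρ hρ, div_eq_inv_mul,
      inv_sinh_geodesicRadius (hΩ.neg_of_mem_logRadii hρ)]
  exact hsep.isSolution_of_isDuffing hΩ hv

theorem not_isRadial_of_eq_div_sinh {v : ℝ → ℝ} {s t : ℝ} (hst : v s ≠ v t)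
    (huv : ∀ r θ, 0 < r → polar r θ ∈ Ω → u (polar r θ) = v θ / sinh r) : ¬ IsRadial Ω u := by
  rintro ⟨f, hf⟩
  obtain ⟨r, hr, hmem⟩ := hΩ.exists_forall_polar_mem
  have hv : ∀ θ, v θ / sinh r = f r := fun θ => by
    rw [← huv r θ hr (hmem θ).1, hf r θ hr (hmem θ).1]
  exact hst ((div_left_inj' (sinh_pos_iff.2 hr).ne').1 ((hv s).trans (hv t).symm))

theorem mem_nonRadialPseudoRadialSolutions_iff (hε : ε ≠ 0) :
    u ∈ nonRadialPseudoRadialSolutions Ω (fun s => ε * s ^ 3) ↔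
      ∃ v, IsDuffing ε v ∧ Function.Periodic v (2 * π) ∧ (∃ s t, v s ≠ v t) ∧
        ∀ r θ, 0 < r → polar r θ ∈ Ω → u (polar r θ) = v θ / sinh r := by
  constructor
  · rintro ⟨hu, hps, hnr⟩
    have hcubic : (fun s : ℝ => ε * s ^ 3) = fun s => ε * (s * |s| ^ ((3 : ℝ) - 1)) := by
      norm_num only [mul_abs_rpow_two]
    exact (exists_isDuffing_of_not_isRadial hΩ hε (by norm_num) (hcubic ▸ hu) hps hnr).2
  · rintro ⟨v, hv, hper, ⟨s, t, hst⟩, huv⟩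
    exact ⟨isSolution_cubic_of_isDuffing hΩ hv huv, ⟨fun r => (sinh r)⁻¹, v, hper,
      fun r θ hr hm => by rw [huv r θ hr hm, div_eq_inv_mul]⟩,
      not_isRadial_of_eq_div_sinh hΩ hst huv⟩

theorem mem_nonRadialPseudoRadialSolutions_iff_modeWave :
    u ∈ nonRadialPseudoRadialSolutions Ω (fun s => -s ^ 3) ↔
      ∃ k, 2 ≤ k ∧ ∃ θ₀, ∀ r θ, 0 < r → polar r θ ∈ Ω →
        u (polar r θ) = modeWave k (θ + θ₀) / sinh r := by
  have hiff := mem_nonRadialPseudoRadialSolutions_iff hΩ (u := u) (neg_ne_zero.2 one_ne_zero)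
  simp only [neg_one_mul] at hiff
  refine hiff.trans ⟨?_, ?_⟩
  · rintro ⟨v, hv, hper, hne, huv⟩
    obtain ⟨k, hk, θ₀, rfl⟩ := hv.exists_eq_modeWave hper hne
    exact ⟨k, hk, θ₀, huv⟩
  · rintro ⟨k, hk, θ₀, huv⟩
    have hperiod := isLeastPeriod_comp_add_const_iff (s := θ₀).2 (isLeastPeriod_modeWave hk)
    exact ⟨_, (isDuffing_modeWave k).comp_add_const θ₀,
      periodic_two_pi_of_isLeastPeriod hk hperiod, hperiod.exists_ne, huv⟩

end RotSymm

/-- The function `v(θ) / sinh r`, for a `2π`-periodic `v`; the angle is the principal argument. -/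
noncomputable def angularProfile (v : ℝ → ℝ) (z : ℂ) : ℝ :=
  v z.arg / sinh (geodesicRadius (log ‖z‖))

theorem angularProfile_polar {v : ℝ → ℝ} (hv : Function.Periodic v (2 * π)) {r : ℝ} (hr : 0 < r)
    (θ : ℝ) : angularProfile v (polar r θ) = v θ / sinh r := by
  have harg : (polar r θ).arg = toIocMod two_pi_pos (-π) θ := by
    rw [polar, Complex.arg_real_mul _ (tanh_half_pos hr), Complex.arg_exp_mul_I]
  rw [angularProfile, harg, toIocMod, hv.sub_zsmul_eq, polar_eq_logPolar hr, norm_logPolar, log_exp,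
    geodesicRadius_log_tanh_half hr]

theorem angularProfile_modeWave_polar {k : ℕ} (hk : 2 ≤ k) {r : ℝ} (hr : 0 < r) (θ : ℝ) :
    angularProfile (modeWave k) (polar r θ) = modeWave k θ / sinh r :=
  angularProfile_polar (periodic_two_pi_of_isLeastPeriod hk (isLeastPeriod_modeWave hk)) hr θ

theorem angularProfile_modeWave_mem {Ω : Set ℂ} (hΩ : IsRotSymmDomain Ω) {k : ℕ} (hk : 2 ≤ k) :
    angularProfile (modeWave k) ∈ nonRadialPseudoRadialSolutions Ω (fun s => -s ^ 3) :=
  (mem_nonRadialPseudoRadialSolutions_iff_modeWave hΩ).2 ⟨k, hk, 0, fun r θ hr _ => by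
    rw [angularProfile_modeWave_polar hk hr, add_zero]⟩

theorem infinite_domRestrict_nonRadialPseudoRadialSolutions {Ω : Set ℂ} (hΩ : IsRotSymmDomain Ω) :
    ((Ω \ {0}).domRestrict ''
      nonRadialPseudoRadialSolutions Ω (fun s => -s ^ 3)).Infinite := by
  obtain ⟨r, hr, hmem⟩ := hΩ.exists_forall_polar_mem
  have hinj : InjOn (fun k => (Ω \ {0}).domRestrict (angularProfile (modeWave k))) (Ici 2) :=
    fun j hj k hk hjk => injOn_modeWave hj hk <| funext fun θ => by
      have hθ := congrFun hjk ⟨_, hmem θ⟩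
      simp only [domRestrict_apply, angularProfile_modeWave_polar hj hr,
        angularProfile_modeWave_polar hk hr] at hθ
      exact (div_left_inj' (sinh_pos_iff.2 hr).ne').1 hθ
  refine ((Ici_infinite 2).image hinj).mono ?_
  rintro _ ⟨k, hk, rfl⟩
  exact mem_image_of_mem _ (angularProfile_modeWave_mem hΩ hk)

end HypPlane

/-- For `q ≤ 0` the nonlinearity takes the value `0` at `s = 0`, as `0 * 0 ^ (q - 1) = 0`. -/
theorem theorem4p6_general (Ω : Set ℂ) (hΩ : HypPlane.IsRotSymmDomain Ω) :
    (∀ ε q : ℝ, ε ≠ 0 → q ≠ 1 → (0 < ε ∨ q ≠ 3) →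
      ∀ u : ℂ → ℝ, HypPlane.IsSolution Ω (fun s => ε * (s * |s| ^ (q - 1))) u →
        HypPlane.IsPseudoRadial Ω u → HypPlane.IsRadial Ω u) ∧
    ((Ω \ {0}).domRestrict ''
        HypPlane.nonRadialPseudoRadialSolutions Ω (fun s => -s ^ 3)).Infinite ∧
    ∃ w : ℕ → ℝ → ℝ,
      (∀ k : ℕ, 2 ≤ k →
        HypPlane.IsModeSolution k (w k) ∧ w k 0 = 0 ∧
        (∀ v : ℝ → ℝ, HypPlane.IsModeSolution k v → v 0 = 0 → v = w k ∨ v = -w k) ∧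
        (∀ v : ℝ → ℝ, HypPlane.IsModeSolution k v → ∃ θ₀ : ℝ, ∀ θ : ℝ, v θ = w k (θ + θ₀)) ∧
        ∃ u ∈ HypPlane.nonRadialPseudoRadialSolutions Ω (fun s => -s ^ 3),
          ∀ r θ : ℝ, 0 < r → HypPlane.polar r θ ∈ Ω →
            u (HypPlane.polar r θ) = w k θ / Real.sinh r) ∧
      (∀ u : ℂ → ℝ,
        u ∈ HypPlane.nonRadialPseudoRadialSolutions Ω (fun s => -s ^ 3) ↔
          ∃ k : ℕ, 2 ≤ k ∧ ∃ θ₀ : ℝ, ∀ r θ : ℝ, 0 < r → HypPlane.polar r θ ∈ Ω →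
            u (HypPlane.polar r θ) = w k (θ + θ₀) / Real.sinh r) := by
  refine ⟨fun ε q hε hq hεq u hu hps =>
      HypPlane.isRadial_of_isPseudoRadial hΩ hε hq hεq hu hps,
    HypPlane.infinite_domRestrict_nonRadialPseudoRadialSolutions hΩ, HypPlane.modeWave,
    fun k hk => ?_, fun u => HypPlane.mem_nonRadialPseudoRadialSolutions_iff_modeWave hΩ⟩
  refine ⟨HypPlane.isModeSolution_modeWave hk, HypPlane.modeWave_zero k,
    fun v hv h0 => hv.eq_or_eq_neg hk h0,
    fun v hv => (hv.exists_eq_modeWave hk).imp fun _ h θ => congrFun h θ,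
    HypPlane.angularProfile (HypPlane.modeWave k), HypPlane.angularProfile_modeWave_mem hΩ hk,
    fun r θ hr _ => HypPlane.angularProfile_modeWave_polar hk hr θ⟩

theorem theorem4p6 (Ω : Set ℂ) (hΩ : HypPlane.IsRotSymmDomain Ω) :
    (∀ ε q : ℝ, (ε = 1 ∨ ε = -1) → 0 < q → q ≠ 1 → (ε = 1 ∨ q ≠ 3) →
      ∀ u : ℂ → ℝ, HypPlane.IsSolution Ω (fun s => ε * (s * |s| ^ (q - 1))) u →
        HypPlane.IsPseudoRadial Ω u → HypPlane.IsRadial Ω u) ∧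
    ((Ω \ {0}).domRestrict ''
        HypPlane.nonRadialPseudoRadialSolutions Ω (fun s => -s ^ 3)).Infinite ∧
    ∃ w : ℕ → ℝ → ℝ,
      (∀ k : ℕ, 2 ≤ k →
        HypPlane.IsModeSolution k (w k) ∧ w k 0 = 0 ∧
        (∀ v : ℝ → ℝ, HypPlane.IsModeSolution k v → v 0 = 0 → v = w k ∨ v = -w k) ∧
        (∀ v : ℝ → ℝ, HypPlane.IsModeSolution k v → ∃ θ₀ : ℝ, ∀ θ : ℝ, v θ = w k (θ + θ₀)) ∧
        ∃ u ∈ HypPlane.nonRadialPseudoRadialSolutions Ω (fun s => -s ^ 3),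
          ∀ r θ : ℝ, 0 < r → HypPlane.polar r θ ∈ Ω →
            u (HypPlane.polar r θ) = w k θ / Real.sinh r) ∧
      (∀ u : ℂ → ℝ,
        u ∈ HypPlane.nonRadialPseudoRadialSolutions Ω (fun s => -s ^ 3) ↔
          ∃ k : ℕ, 2 ≤ k ∧ ∃ θ₀ : ℝ, ∀ r θ : ℝ, 0 < r → HypPlane.polar r θ ∈ Ω →
            u (HypPlane.polar r θ) = w k (θ + θ₀) / Real.sinh r) := by
  obtain ⟨hradial, hcubic⟩ := theorem4p6_general Ω hΩ
  exact ⟨fun ε q hε _ hq hεq => hradial ε q (by rcases hε with rfl | rfl <;> norm_num) hq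
    (hεq.imp_left fun h => one_pos.trans_eq h.symm), hcubic⟩
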